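/- Let $\Omega\subseteq\mathbb R^d$ be open. Let $H^1(\Omega)$ be the Sobolev space of functions in $L^2(\Omega)$ with weak gradient in $L^2(\Omega)$, with norm $\|u\|_{H^1(\Omega)}^2=\|u\|_{L^2(\Omega)}^2+\|\nabla u\|_{L^2(\Omega)}^2$, and let $H^1_0(\Omega)$ be the closure of $C_c^\infty(\Omega)$ in $H^1(\Omega)$. Let $L^2(\partial\Omega)$ be taken with respect to the $(d-1)$-dimensional surface (Hausdorff) measure $\mathrm ds$ on $\partial\Omega$. Assume that $\Omega$ has a trace operator, i.e. that the restriction to $\partial\Omega$ of those Lipschitz continuous functions on $\overline\Omega$ that belong to $H^1(\Omega)$ has exactly one bounded linear extension $\operatorname{tr}\colon H^1(\Omega)\to L^2(\partial\Omega)$ (for example, $\Omega$ a bounded Lipschitz domain), and that $L^2(\partial\Omega)$ is infinite-dimensional (for such a nonempty domain: $d\ge 2$). Boundary integrals of elements of $H^1(\Omega)$ are understood via $\operatorname{tr}$. Let $a\colon H^1(\Omega)\times H^1(\Omega)\to\mathbb R$ be a continuous, symmetric, positive semi-definite bilinear form, put $$a_1(u,v)=a(u,v)+\int_{\partial\Omega}uv\,\mathrm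 ds,$$ and assume that $a_1$ is coercive on $H^1(\Omega)$, i.e. $a_1(u,u)\ge\alpha\|u\|_{H^1(\Omega)}^2$ for some $\alpha>0$ and all $u\in H^1(\Omega)$. Let $$\mathcal H(\Omega)=\{w\in H^1(\Omega)\mid a(w,v)=0\text{ for all }v\in H^1_0(\Omega)\},$$ with the norm of $H^1(\Omega)$, and assume that $\mathcal H(\Omega)\hookrightarrow L^2(\partial\Omega)$, $w\mapsto\operatorname{tr}(w)$, is a compact embedding, i.e. an injective compact operator. Then there exist a non-decreasing sequence $(\mu_j)_{j\in\mathbb N}\subseteq[0,\infty)$ with $\mu_j\to\infty$ and a sequence $(e_j)_{j\in\mathbb N}\subseteq\mathcal H(\Omega)$ such that every $\mu_j$ is a Steklov eigenvalue with eigenfunction $e_j$, i.e. $e_j\neq0$ and $$a(e_j,\varphi)=\mu_j\int_{\partial\Omega}e_j\varphi\,\mathrm ds\quad\text{for all }\varphi\in H^1(\Omega),$$ and $(e_j)_{j\in\mathbb N}$ is a complete orthonormal system of $\mathcal H(\Omega)$ with respect to $a_1$, i.e. $a_1(e_i,e_j)=\delta_{ij}$ and the linear span of $(e_j)_{j\in\mathbb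 N}$ is dense in $\mathcal H(\Omega)$ for the norm $a_1(w,w)^{1/2}$. -/

import Mathlib

open MeasureTheory
open scoped ContDiff

namespace Steklov

/-- `φ ∈ C_c^∞(Ω)`: smooth on the whole space, with compact support inside `Ω`. -/
def IsTestFunction {d : ℕ} (Ω : Set (EuclideanSpace ℝ (Fin d)))
    (φ : EuclideanSpace ℝ (Fin d) → ℝ) : Prop :=
  ContDiff ℝ ∞ φ ∧ HasCompactSupport φ ∧ tsupport φ ⊆ Ω

/-- `g` is a weak gradient of `u` on `Ω`: the directional derivatives in every direction `y`
satisfy `∫_Ω u ∂_y φ = - ∫_Ω (g · y) φ` for all test functions `φ`. -/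
def IsWeakGradient {d : ℕ} (Ω : Set (EuclideanSpace ℝ (Fin d)))
    (u : EuclideanSpace ℝ (Fin d) → ℝ)
    (g : EuclideanSpace ℝ (Fin d) → EuclideanSpace ℝ (Fin d)) : Prop :=
  ∀ φ : EuclideanSpace ℝ (Fin d) → ℝ, IsTestFunction Ω φ → ∀ y : EuclideanSpace ℝ (Fin d),
    ∫ x in Ω, u x * fderiv ℝ φ x y = - ∫ x in Ω, inner ℝ (g x) y * φ x

theorem IsTestFunction.memLp {d : ℕ} {Ω : Set (EuclideanSpace ℝ (Fin d))}
    {φ : EuclideanSpace ℝ (Fin d) → ℝ} (hφ : IsTestFunction Ω φ) :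
    MemLp φ 2 (volume.restrict Ω) :=
  (hφ.1.continuous.memLp_of_hasCompactSupport hφ.2.1).restrict Ω

theorem IsTestFunction.memLp_fderiv {d : ℕ} {Ω : Set (EuclideanSpace ℝ (Fin d))}
    {φ : EuclideanSpace ℝ (Fin d) → ℝ} (hφ : IsTestFunction Ω φ)
    (y : EuclideanSpace ℝ (Fin d)) :
    MemLp (fun x => fderiv ℝ φ x y) 2 (volume.restrict Ω) := by
  have h1 : Continuous (fun x => fderiv ℝ φ x y) :=
    (hφ.1.continuous_fderiv (by simp)).clm_apply continuous_const
  have h2 : HasCompactSupport (fun x => fderiv ℝ φ x y) :=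
    hφ.2.1.fderiv_apply (𝕜 := ℝ) y
  exact (h1.memLp_of_hasCompactSupport h2).restrict Ω

theorem memLp_inner_const {d : ℕ} {Ω : Set (EuclideanSpace ℝ (Fin d))}
    {g : EuclideanSpace ℝ (Fin d) → EuclideanSpace ℝ (Fin d)}
    (hg : MemLp g 2 (volume.restrict Ω)) (y : EuclideanSpace ℝ (Fin d)) :
    MemLp (fun x => inner ℝ (g x) y) 2 (volume.restrict Ω) :=
  hg.inner_const y

/-- The space `H¹(Ω)`, realised as the space of all pairs `(u, ∇u)` with `u ∈ L²(Ω)` whose weak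
gradient `∇u` exists and lies in `L²(Ω; ℝ^d)`. The norm inherited from the `ℓ²`-product is
`‖u‖² = ‖u‖²_{L²(Ω)} + ‖∇u‖²_{L²(Ω)}`. -/
noncomputable def sobolevH1 {d : ℕ} (Ω : Set (EuclideanSpace ℝ (Fin d))) :
    Submodule ℝ (WithLp 2 (Lp ℝ 2 (volume.restrict Ω) ×
      Lp (EuclideanSpace ℝ (Fin d)) 2 (volume.restrict Ω))) where
  carrier := {p | IsWeakGradient Ω p.fst p.snd}
  zero_mem' := by
    intro φ hφ y
    have h1 : ∫ x in Ω, (0 : Lp ℝ 2 (volume.restrict Ω)) x * fderiv ℝ φ x y = 0 := by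
      apply integral_eq_zero_of_ae
      filter_upwards [Lp.coeFn_zero ℝ 2 (volume.restrict Ω)] with x hx
      rw [hx]; simp
    have h2 : ∫ x in Ω, inner ℝ
        ((0 : Lp (EuclideanSpace ℝ (Fin d)) 2 (volume.restrict Ω)) x) y * φ x = 0 := by
      apply integral_eq_zero_of_ae
      filter_upwards [Lp.coeFn_zero (EuclideanSpace ℝ (Fin d)) 2 (volume.restrict Ω)] with x hx
      rw [hx]; simp
    simp only [WithLp.zero_fst, WithLp.zero_snd]
    rw [h1, h2, neg_zero]
  add_mem' := by
    intro p q hp hq φ hφ y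
    have h1 : ∫ x in Ω, (p.fst + q.fst : Lp ℝ 2 (volume.restrict Ω)) x * fderiv ℝ φ x y =
        (∫ x in Ω, p.fst x * fderiv ℝ φ x y) + ∫ x in Ω, q.fst x * fderiv ℝ φ x y := by
      refine Eq.trans ?_ (integral_add ((Lp.memLp p.fst).integrable_mul (hφ.memLp_fderiv y))
        ((Lp.memLp q.fst).integrable_mul (hφ.memLp_fderiv y)))
      apply integral_congr_ae
      filter_upwards [Lp.coeFn_add p.fst q.fst] with x hx
      rw [hx]
      simp [add_mul]
    have h2 : ∫ x in Ω, inner ℝ ((p.snd + q.snd :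
          Lp (EuclideanSpace ℝ (Fin d)) 2 (volume.restrict Ω)) x) y * φ x =
        (∫ x in Ω, inner ℝ (p.snd x) y * φ x) + ∫ x in Ω, inner ℝ (q.snd x) y * φ x := by
      refine Eq.trans ?_ (integral_add
        ((memLp_inner_const (Lp.memLp p.snd) y).integrable_mul hφ.memLp)
        ((memLp_inner_const (Lp.memLp q.snd) y).integrable_mul hφ.memLp))
      apply integral_congr_ae
      filter_upwards [Lp.coeFn_add p.snd q.snd] with x hx
      rw [hx]
      simp [inner_add_left, add_mul]
    simp only [WithLp.add_fst, WithLp.add_snd]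
    rw [h1, h2, hp φ hφ y, hq φ hφ y]
    ring
  smul_mem' := by
    intro c p hp φ hφ y
    have h1 : ∫ x in Ω, (c • p.fst : Lp ℝ 2 (volume.restrict Ω)) x * fderiv ℝ φ x y =
        c * ∫ x in Ω, p.fst x * fderiv ℝ φ x y := by
      rw [← integral_const_mul]
      apply integral_congr_ae
      filter_upwards [Lp.coeFn_smul c p.fst] with x hx
      simp [hx, mul_assoc]
    have h2 : ∫ x in Ω, inner ℝ ((c • p.snd :
          Lp (EuclideanSpace ℝ (Fin d)) 2 (volume.restrict Ω)) x) y * φ x =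
        c * ∫ x in Ω, inner ℝ (p.snd x) y * φ x := by
      rw [← integral_const_mul]
      apply integral_congr_ae
      filter_upwards [Lp.coeFn_smul c p.snd] with x hx
      simp [hx, inner_smul_left, mul_assoc]
    simp only [WithLp.smul_fst, WithLp.smul_snd]
    rw [h1, h2, hp φ hφ y]
    ring

/-- `H¹(Ω)` as a type, with the inner product `(u, v) ↦ ∫_Ω u v + ∇u · ∇v`. -/
def H1 {d : ℕ} (Ω : Set (EuclideanSpace ℝ (Fin d))) : Type := ↥(sobolevH1 Ω)

noncomputable instance {d : ℕ} (Ω : Set (EuclideanSpace ℝ (Fin d))) : NormedAddCommGroup (H1 Ω) :=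
  inferInstanceAs (NormedAddCommGroup ↥(sobolevH1 Ω))

noncomputable instance {d : ℕ} (Ω : Set (EuclideanSpace ℝ (Fin d))) :
    InnerProductSpace ℝ (H1 Ω) :=
  inferInstanceAs (InnerProductSpace ℝ ↥(sobolevH1 Ω))

/-- The function in `L²(Ω)` underlying an element of `H¹(Ω)`. -/
noncomputable def H1.toL2 {d : ℕ} {Ω : Set (EuclideanSpace ℝ (Fin d))} (u : H1 Ω) :
    Lp ℝ 2 (volume.restrict Ω) :=
  u.1.fst

/-- The weak gradient of an element of `H¹(Ω)`. -/
noncomputable def H1.grad {d : ℕ} {Ω : Set (EuclideanSpace ℝ (Fin d))} (u : H1 Ω) :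
    Lp (EuclideanSpace ℝ (Fin d)) 2 (volume.restrict Ω) :=
  u.1.snd

theorem IsTestFunction.zero {d : ℕ} (Ω : Set (EuclideanSpace ℝ (Fin d))) :
    IsTestFunction Ω (fun _ => (0 : ℝ)) :=
  ⟨contDiff_const, HasCompactSupport.zero, by
    rw [show tsupport (fun _ : EuclideanSpace ℝ (Fin d) => (0 : ℝ)) = ∅ from
      tsupport_eq_empty_iff.2 rfl]
    exact Set.empty_subset _⟩

/-- `C_c^∞(Ω)` as a subspace of `H¹(Ω)`. -/
noncomputable def testFunctions {d : ℕ} (Ω : Set (EuclideanSpace ℝ (Fin d))) :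
    Submodule ℝ (H1 Ω) where
  carrier := {u | ∃ φ : EuclideanSpace ℝ (Fin d) → ℝ, IsTestFunction Ω φ ∧
    u.toL2 =ᵐ[volume.restrict Ω] φ}
  zero_mem' := ⟨fun _ => 0, IsTestFunction.zero Ω, Lp.coeFn_zero ℝ 2 (volume.restrict Ω)⟩
  add_mem' := by
    rintro u v ⟨φ, hφ, hu⟩ ⟨ψ, hψ, hv⟩
    refine ⟨φ + ψ, ⟨hφ.1.add hψ.1, hφ.2.1.add hψ.2.1,
      (tsupport_add φ ψ).trans (Set.union_subset hφ.2.2 hψ.2.2)⟩, ?_⟩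
    exact (Lp.coeFn_add u.toL2 v.toL2).trans (hu.add hv)
  smul_mem' := by
    rintro c u ⟨φ, hφ, hu⟩
    refine ⟨c • φ, ⟨contDiff_const.smul hφ.1, hφ.2.1.smul_left (f := fun _ => c),
      (tsupport_smul_subset_right (fun _ => c) φ).trans hφ.2.2⟩, ?_⟩
    exact (Lp.coeFn_smul c u.toL2).trans (hu.const_smul c)

/-- `H¹₀(Ω)`, the closure of `C_c^∞(Ω)` in `H¹(Ω)`. -/
noncomputable def H10 {d : ℕ} (Ω : Set (EuclideanSpace ℝ (Fin d))) : Submodule ℝ (H1 Ω) :=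
  (testFunctions Ω).topologicalClosure

/-- Surface measure on `∂Ω`: the `(d-1)`-dimensional Hausdorff measure, normalised so that it is
the usual area on hyperplanes, restricted to the topological boundary. -/
noncomputable def surfaceMeasure {d : ℕ} (Ω : Set (EuclideanSpace ℝ (Fin d))) :
    Measure (EuclideanSpace ℝ (Fin d)) :=
  (Measure.euclideanHausdorffMeasure (d - 1)).restrict (frontier Ω)

/-- `L²(∂Ω)`. -/
abbrev L2Boundary {d : ℕ} (Ω : Set (EuclideanSpace ℝ (Fin d))) : Type :=
  ↥(Lp ℝ 2 (surfaceMeasure Ω))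

/-- `T` is a bounded linear extension to `H¹(Ω)` of the operator that restricts Lipschitz functions
on the closure of `Ω` to the boundary. -/
def ExtendsRestriction {d : ℕ} (Ω : Set (EuclideanSpace ℝ (Fin d)))
    (T : H1 Ω →L[ℝ] L2Boundary Ω) : Prop :=
  ∀ (v : EuclideanSpace ℝ (Fin d) → ℝ), (∃ K : NNReal, LipschitzOnWith K v (closure Ω)) →
    ∀ u : H1 Ω, u.toL2 =ᵐ[volume.restrict Ω] v → T u =ᵐ[surfaceMeasure Ω] v

/-- `Ω` has a trace operator: restriction to the boundary has exactly one bounded linear extension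
`H¹(Ω) → L²(∂Ω)`. Bounded Lipschitz domains have this property. -/
def AdmitsTrace {d : ℕ} (Ω : Set (EuclideanSpace ℝ (Fin d))) : Prop :=
  ∃! T : H1 Ω →L[ℝ] L2Boundary Ω, ExtendsRestriction Ω T

open Classical in
/-- The trace operator `tr : H¹(Ω) → L²(∂Ω)` (set to `0` if `Ω` does not admit one). -/
noncomputable def trace {d : ℕ} (Ω : Set (EuclideanSpace ℝ (Fin d))) :
    H1 Ω →L[ℝ] L2Boundary Ω :=
  if h : AdmitsTrace Ω then h.choose else 0

/-- `∫_{∂Ω} u v ds`, in the sense of traces. -/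
noncomputable def boundaryForm {d : ℕ} {Ω : Set (EuclideanSpace ℝ (Fin d))} (u v : H1 Ω) : ℝ :=
  ∫ x, trace Ω u x * trace Ω v x ∂(surfaceMeasure Ω)

/-- `a₁(u, v) = a(u, v) + ∫_{∂Ω} u v ds`. -/
noncomputable def form1 {d : ℕ} {Ω : Set (EuclideanSpace ℝ (Fin d))}
    (a : H1 Ω →L[ℝ] H1 Ω →L[ℝ] ℝ) (u v : H1 Ω) : ℝ :=
  a u v + boundaryForm u v

/-- The space `ℋ(Ω)` of weakly `a`-harmonic functions, with the topology of `H¹(Ω)`. -/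
def harmonicSpace {d : ℕ} {Ω : Set (EuclideanSpace ℝ (Fin d))}
    (a : H1 Ω →L[ℝ] H1 Ω →L[ℝ] ℝ) : Submodule ℝ (H1 Ω) where
  carrier := {w | ∀ v ∈ H10 Ω, a w v = 0}
  zero_mem' := by intro v _; simp
  add_mem' := by intro w z hw hz v hv; simp [hw v hv, hz v hv]
  smul_mem' := by intro c w hw v hv; simp [hw v hv]

/-- `μ` is a Steklov eigenvalue with eigenfunction `w`. -/
def IsSteklovEigenpair {d : ℕ} {Ω : Set (EuclideanSpace ℝ (Fin d))}
    (a : H1 Ω →L[ℝ] H1 Ω →L[ℝ] ℝ) (μ : ℝ) (w : H1 Ω) : Prop :=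
  w ≠ 0 ∧ ∀ φ : H1 Ω, a w φ = μ * boundaryForm w φ

/-- The sequence `e` is a complete orthonormal system of the subspace `W` with respect to the
bilinear form `b`: it lies in `W`, it is `b`-orthonormal, and its linear span is dense in `W` for
the norm `w ↦ b(w, w)^{1/2}`. -/
def IsCompleteOrthonormalSystem {V : Type*} [AddCommGroup V] [Module ℝ V]
    (b : V → V → ℝ) (W : Submodule ℝ V) (e : ℕ → V) : Prop :=
  (∀ j, e j ∈ W) ∧
  (∀ i j, b (e i) (e j) = if i = j then 1 else 0) ∧
  ∀ w ∈ W, ∀ ε > 0, ∃ v ∈ Submodule.span ℝ (Set.range e), b (w - v) (w - v) < ε ^ 2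

end Steklov

/-!
Write `T` for the trace and `N = H¹₀(Ω)`. The form `a₁ = a + ⟨T ·, T ·⟩` is symmetric, bounded and
coercive, hence the inner product of an isomorphic Hilbert space
(`exists_equiv_inner_eq_of_coercive`). Test functions vanish on `∂Ω`, so `T = 0` on `N`; therefore
`a₁` and `a` agree against `N`, the `a`-harmonic space is the `a₁`-orthogonal complement of `N`,
and every element of `H¹(Ω)` has a harmonic part with the same trace.

On the harmonic space, `S = T†T` (adjoint with respect to `a₁`) is compact, and positive definite
since `T` is injective there. The spectral theorem in sorted form
(`exists_orthonormal_eigenvectors_antitone`) gives an `a₁`-orthonormal complete sequence `e j` with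
eigenvalues `l j` decreasing to `0`; the `j`-th eigenvector is found by restricting `S` to the
orthogonal complement of the previous ones, where its norm is an eigenvalue. The relation
`⟨T e, T φ⟩ = l a₁(e, φ)`, first for harmonic `φ`, extends to all `φ` by the decomposition above,
and says that `e` is a Steklov eigenfunction for `μ = 1/l - 1`; here `l ≤ 1` as `a ≥ 0`.

A full sequence exists because the harmonic space is infinite-dimensional: the traces of smooth
compactly supported functions are dense in `L²(∂Ω)` (`dense_range_trace`). That uses local
finiteness of the surface measure, which follows from the existence of the trace operator, as
smooth cutoff functions have square integrable traces.
-/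

/-! ### Renorming by a coercive form -/

/-- A coercive symmetric bounded bilinear form on a Hilbert space is the inner product of an
isomorphic Hilbert space. -/
theorem exists_equiv_inner_eq_of_coercive.{u} {V : Type u} [NormedAddCommGroup V]
    [InnerProductSpace ℝ V] [CompleteSpace V] (B : V →L[ℝ] V →L[ℝ] ℝ)
    (hsymm : ∀ u v, B u v = B v u) {α : ℝ} (hα : 0 < α) (hB : ∀ u, α * ‖u‖ ^ 2 ≤ B u u) :
    ∃ (E : Type u) (_ : NormedAddCommGroup E) (_ : InnerProductSpace ℝ E) (_ : CompleteSpace E)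
      (Φ : V ≃L[ℝ] E), ∀ u v, inner ℝ (Φ u) (Φ v) = B u v := by
  -- an opaque copy of the vector space `V` that does not see the norm of `V`
  obtain ⟨E, instE, modE, ⟨f⟩⟩ : ∃ (E : Type u) (_ : AddCommGroup E) (_ : Module ℝ E),
      Nonempty (V ≃ₗ[ℝ] E) := ⟨V, inferInstance, inferInstance, ⟨LinearEquiv.refl ℝ V⟩⟩
  let c : InnerProductSpace.Core ℝ E :=
    { inner := fun x y => B (f.symm x) (f.symm y)
      conj_inner_symm := fun x y => by simp [hsymm (f.symm x)]
      re_inner_nonneg := fun x => by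
        have := hB (f.symm x)
        simp only [RCLike.re_to_real]
        exact le_trans (by positivity) this
      add_left := fun x y z => by simp
      smul_left := fun x y r => by simp
      definite := fun x hx => by
        have h := hB (f.symm x)
        have hx' : B (f.symm x) (f.symm x) = 0 := hx
        have h0 : ‖f.symm x‖ ^ 2 ≤ 0 := by
          by_contra hlt
          have := mul_pos hα (not_le.1 hlt)
          linarith
        have h1 : ‖f.symm x‖ = 0 := by
          have := sq_nonneg ‖f.symm x‖
          exact pow_eq_zero_iff two_ne_zero |>.1 (le_antisymm h0 this)
        simpa using h1 }
  let _ : NormedAddCommGroup E := c.toNormedAddCommGroup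
  let _ : InnerProductSpace ℝ E := InnerProductSpace.ofCore c.toCore
  have hin : ∀ u v, inner ℝ (f u) (f v) = B u v := fun u v => by
    change B (f.symm (f u)) (f.symm (f v)) = _
    simp
  have hnorm : ∀ u, ‖f u‖ ^ 2 = B u u := fun u => by
    rw [← hin, real_inner_self_eq_norm_sq]
  have hup : ∀ u, ‖f u‖ ≤ √‖B‖ * ‖u‖ := fun u => by
    refine pow_le_pow_iff_left₀ (norm_nonneg _) (by positivity) two_ne_zero |>.1 ?_
    rw [hnorm, mul_pow, Real.sq_sqrt (norm_nonneg B)]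
    calc B u u ≤ ‖B u u‖ := Real.le_norm_self _
      _ ≤ ‖B‖ * ‖u‖ * ‖u‖ := B.le_opNorm₂ u u
      _ = _ := by ring
  have hlow : ∀ x, ‖f.symm x‖ ≤ √α⁻¹ * ‖x‖ := fun x => by
    refine pow_le_pow_iff_left₀ (norm_nonneg _) (by positivity) two_ne_zero |>.1 ?_
    have h := hnorm (f.symm x)
    rw [f.apply_symm_apply] at h
    rw [mul_pow, Real.sq_sqrt (by positivity), h, inv_mul_eq_div, le_div_iff₀ hα, mul_comm]
    exact hB _
  let Φ : V ≃L[ℝ] E := f.toContinuousLinearEquivOfBounds _ _ hup hlow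
  refine ⟨E, inferInstance, inferInstance, ?_, Φ, hin⟩
  exact (completeSpace_congr (e := Φ.toEquiv) Φ.isUniformEmbedding).1 inferInstance

/-! ### Compact positive definite operators -/

section Compact

variable {E : Type*} [NormedAddCommGroup E] [InnerProductSpace ℝ E]

/-- A positive definite compact symmetric operator on a nontrivial Hilbert space has its norm as an
eigenvalue, because the spectral radius equals the norm. -/
theorem exists_eigenvector_norm [CompleteSpace E] [Nontrivial E] {S : E →L[ℝ] E}
    (hS : IsCompactOperator S)
    (hsymm : S.IsSymmetric) (hpos : ∀ x, x ≠ 0 → 0 < inner ℝ x (S x)) :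
    ∃ e : E, ‖e‖ = 1 ∧ S e = ‖S‖ • e := by
  have hS0 : S ≠ 0 := by
    rintro rfl
    obtain ⟨x, hx⟩ := exists_ne (0 : E)
    simpa using hpos x hx
  have hrad := S.spectralRadius_eq_nnnorm hsymm.isSelfAdjoint
  have hne : (spectrum ℝ S).Nonempty := by
    by_contra h
    rw [Set.not_nonempty_iff_eq_empty] at h
    simp only [spectralRadius, h, Set.mem_empty_iff_false, iSup_false, iSup_bot] at hrad
    exact hS0 (by simpa using hrad.symm)
  obtain ⟨z, hz, hzn⟩ := spectrum.exists_nnnorm_eq_spectralRadius_of_nonempty hne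
  rw [hrad, ENNReal.coe_inj] at hzn
  have hzn' : ‖z‖ = ‖S‖ := congrArg NNReal.toReal hzn
  have hz0 : z ≠ 0 := by
    rintro rfl
    exact hS0 (norm_eq_zero.1 (by rw [← hzn', norm_zero]))
  have hev := (hS.hasEigenvalue_iff_mem_spectrum hz0).2 hz
  obtain ⟨v, hv⟩ := hev.exists_hasEigenvector
  have hSv : S v = z • v := hv.apply_eq_smul
  have hv0 : v ≠ 0 := hv.2
  have hzpos : 0 < z := by
    have h := hpos v hv0
    rw [hSv, inner_smul_right, real_inner_self_eq_norm_sq] at h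
    exact (pos_iff_pos_of_mul_pos h).2 (by positivity)
  have hzS : z = ‖S‖ := by rw [← hzn', Real.norm_of_nonneg hzpos.le]
  refine ⟨‖v‖⁻¹ • v, ?_, ?_⟩
  · rw [norm_smul, norm_inv, norm_norm, inv_mul_cancel₀ (norm_ne_zero_iff.2 hv0)]
  · rw [map_smul, hSv, hzS, smul_comm]

/-- On the orthogonal complement of a finite-dimensional invariant subspace, the quadratic form of
a compact positive definite operator attains its maximum at an eigenvector. -/
theorem exists_eigenvector_maximal_orthogonal [CompleteSpace E]
    (hinf : ¬ FiniteDimensional ℝ E) {S : E →L[ℝ] E} (hS : IsCompactOperator S)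
    (hsymm : S.IsSymmetric) (hpos : ∀ x, x ≠ 0 → 0 < inner ℝ x (S x)) (F : Submodule ℝ E) [FiniteDimensional ℝ F]
    (hF : ∀ x ∈ F, S x ∈ F) :
    ∃ (e : E) (l : ℝ), e ∈ Fᗮ ∧ ‖e‖ = 1 ∧ S e = l • e ∧
      ∀ x ∈ Fᗮ, inner ℝ x (S x) ≤ l * ‖x‖ ^ 2 := by
  have hinv : ∀ x ∈ Fᗮ, S x ∈ Fᗮ := fun x hx y hy => by
    exact (hsymm y x).symm.trans (hx _ (hF y hy))
  have : Nontrivial Fᗮ := by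
    rw [Submodule.nontrivial_iff_ne_bot]
    intro h
    rw [Submodule.orthogonal_eq_bot_iff] at h
    subst h
    exact hinf (Module.Finite.equiv (Submodule.topEquiv (R := ℝ) (M := E)))
  let S' : Fᗮ →L[ℝ] Fᗮ := S.restrict hinv
  have hS'c : IsCompactOperator S' := hS.restrict' hinv
  have hS's : S'.IsSymmetric := hsymm.restrict_invariant hinv
  obtain ⟨e, he, hSe⟩ := exists_eigenvector_norm hS'c hS's
    (fun x hx => hpos x (by simpa using hx))
  refine ⟨e, ‖S'‖, e.2, he, congrArg Subtype.val hSe, fun x hx => ?_⟩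
  calc inner ℝ x (S x) = inner ℝ (⟨x, hx⟩ : Fᗮ) (S' ⟨x, hx⟩) := rfl
    _ ≤ ‖(⟨x, hx⟩ : Fᗮ)‖ * ‖S' ⟨x, hx⟩‖ := real_inner_le_norm _ _
    _ ≤ ‖(⟨x, hx⟩ : Fᗮ)‖ * (‖S'‖ * ‖(⟨x, hx⟩ : Fᗮ)‖) := by gcongr; exact S'.le_opNorm _
    _ = ‖S'‖ * ‖x‖ ^ 2 := by rw [Submodule.coe_norm]; ring

/-- Eigenvalues of a compact operator along an orthonormal sequence get arbitrarily small: the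
images of the unit vectors would otherwise be uniformly separated in a compact set. -/
theorem exists_eigenvalue_lt_of_orthonormal {S : E →L[ℝ] E} (hS : IsCompactOperator S)
    {e : ℕ → E} (he : Orthonormal ℝ e) {l : ℕ → ℝ} (hl : ∀ j, S (e j) = l j • e j)
    {ε : ℝ} (hε : 0 < ε) : ∃ j, l j < ε := by
  by_contra! h
  obtain ⟨K, hK, hSK⟩ := IsCompactOperator.image_closedBall_subset_compact
    (f := S.toLinearMap) hS 1
  obtain ⟨y, -, φ, hφ, hy⟩ := hK.tendsto_subseq (x := fun j => S (e j))
    (fun j => hSK ⟨e j, by simp [he.1 j], rfl⟩)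
  obtain ⟨N, hN⟩ := Metric.cauchySeq_iff'.1 hy.cauchySeq ε hε
  have h1 := hN (N + 1) (Nat.le_succ N)
  have hne : φ (N + 1) ≠ φ N := (hφ (Nat.lt_succ_self N)).ne'
  have h2 : ‖S (e (φ (N + 1))) - S (e (φ N))‖ ^ 2 = l (φ (N + 1)) ^ 2 + l (φ N) ^ 2 := by
    rw [hl, hl, @norm_sub_sq ℝ, norm_smul, norm_smul, he.1, he.1, inner_smul_left,
      inner_smul_right, he.2 hne]
    simp
  rw [dist_eq_norm] at h1
  have h3 : ‖S (e (φ (N + 1))) - S (e (φ N))‖ ^ 2 < ε ^ 2 := by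
    gcongr
    exact h1
  have h4 : ε ^ 2 ≤ l (φ (N + 1)) ^ 2 := by gcongr; exact h _
  nlinarith [sq_nonneg (l (φ N))]

/-- **Spectral theorem** for a positive definite compact operator on an infinite-dimensional Hilbert
space, with the eigenvalues listed in non-increasing order. -/
theorem exists_orthonormal_eigenvectors_antitone [CompleteSpace E]
    (hinf : ¬ FiniteDimensional ℝ E) {S : E →L[ℝ] E} (hS : IsCompactOperator S)
    (hsymm : S.IsSymmetric) (hpos : ∀ x, x ≠ 0 → 0 < inner ℝ x (S x)) :
    ∃ (e : ℕ → E) (l : ℕ → ℝ), Orthonormal ℝ e ∧ (∀ j, S (e j) = l j • e j) ∧ (∀ j, 0 < l j) ∧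
      Antitone l ∧ Filter.Tendsto l Filter.atTop (nhds 0) ∧
      (Submodule.span ℝ (Set.range e)).topologicalClosure = ⊤ := by
  let P := {F : Submodule ℝ E // FiniteDimensional ℝ F ∧ ∀ x ∈ F, S x ∈ F}
  have key : ∀ F : P, ∃ (e : E) (l : ℝ), e ∈ F.1ᗮ ∧ ‖e‖ = 1 ∧ S e = l • e ∧
      ∀ x ∈ F.1ᗮ, inner ℝ x (S x) ≤ l * ‖x‖ ^ 2 := fun F =>
    have := F.2.1
    exists_eigenvector_maximal_orthogonal hinf hS hsymm hpos F.1 F.2.2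
  choose v m hv hv1 hSv hmax using key
  -- adjoin the next eigenvector to an invariant subspace
  let next : P → P := fun F => ⟨F.1 ⊔ Submodule.span ℝ {v F}, by
    have := F.2.1
    refine ⟨inferInstance, fun x hx => ?_⟩
    obtain ⟨y, hy, z, hz, rfl⟩ := Submodule.mem_sup.1 hx
    obtain ⟨c, rfl⟩ := Submodule.mem_span_singleton.1 hz
    rw [map_add, map_smul, hSv]
    exact Submodule.add_mem_sup (F.2.2 y hy) (Submodule.smul_mem _ _
      (Submodule.smul_mem _ _ (Submodule.mem_span_singleton_self _)))⟩
  let F : ℕ → P := fun n => next^[n] ⟨⊥, inferInstance, by simp⟩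
  have hFs : ∀ n, (F (n + 1)).1 = (F n).1 ⊔ Submodule.span ℝ {v (F n)} := fun n => by
    simp only [F, Function.iterate_succ_apply']
    rfl
  have hmono : Monotone fun n => (F n).1 := monotone_nat_of_le_succ fun n => by
    rw [hFs]; exact le_sup_left
  have hmem : ∀ i j, i < j → v (F i) ∈ (F j).1 := fun i j hij => by
    refine hmono (Nat.succ_le_of_lt hij) ?_
    simp only [Nat.succ_eq_add_one, hFs]
    exact Submodule.mem_sup_right (Submodule.mem_span_singleton_self _)
  have hon : Orthonormal ℝ fun n => v (F n) := by
    refine ⟨fun n => hv1 _, fun i j hij => ?_⟩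
    rcases lt_or_gt_of_ne hij with h | h
    · exact hv (F j) _ (hmem i j h)
    · rw [real_inner_comm]
      exact hv (F i) _ (hmem j i h)
  have heig : ∀ j, inner ℝ (v (F j)) (S (v (F j))) = m (F j) := fun j => by
    rw [hSv, inner_smul_right, real_inner_self_eq_norm_sq, hv1]; simp
  have hlpos : ∀ j, 0 < m (F j) := fun j => by
    rw [← heig]
    exact hpos _ (norm_ne_zero_iff.1 (by rw [hv1]; exact one_ne_zero))
  have hanti : Antitone fun n => m (F n) := fun i j hij => by
    have h := hmax (F i) (v (F j)) (Submodule.orthogonal_le (hmono hij) (hv (F j)))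
    rw [heig, hv1] at h
    simpa using h
  have htend : Filter.Tendsto (fun n => m (F n)) Filter.atTop (nhds 0) := by
    rw [Metric.tendsto_atTop]
    intro ε hε
    obtain ⟨N, hN⟩ := exists_eigenvalue_lt_of_orthonormal hS hon (fun j => hSv (F j)) hε
    refine ⟨N, fun n hn => ?_⟩
    rw [Real.dist_0_eq_abs, abs_of_pos (hlpos n)]
    exact (hanti hn).trans_lt hN
  refine ⟨fun n => v (F n), fun n => m (F n), hon, fun j => hSv _, hlpos, hanti, htend, ?_⟩
  rw [Submodule.topologicalClosure_eq_top_iff, Submodule.eq_bot_iff]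
  intro w hw
  have hF : ∀ n, (F n).1 ≤ Submodule.span ℝ (Set.range fun n => v (F n)) := fun n => by
    induction n with
    | zero => exact bot_le
    | succ n ih =>
      rw [hFs]
      exact sup_le ih (Submodule.span_mono (by rintro _ rfl; exact ⟨n, rfl⟩))
  by_contra hw0
  have h1 : ∀ n, inner ℝ w (S w) ≤ m (F n) * ‖w‖ ^ 2 := fun n =>
    hmax (F n) w (Submodule.orthogonal_le (hF n) hw)
  have h2 := ge_of_tendsto' (htend.mul_const (‖w‖ ^ 2)) h1
  rw [zero_mul] at h2
  exact absurd (hpos w hw0) (not_lt.2 h2)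

end Compact

/-! ### The abstract Steklov problem -/

/-- The Steklov spectral theorem for abstract Hilbert spaces: `N` plays the role of `H¹₀(Ω)`, `W`
that of the `a`-harmonic functions and `T` that of the trace. -/
theorem exists_complete_orthonormal_eigenpairs {H G : Type*} [NormedAddCommGroup H]
    [InnerProductSpace ℝ H] [CompleteSpace H] [NormedAddCommGroup G] [InnerProductSpace ℝ G]
    [CompleteSpace G] (T : H →L[ℝ] G) (a : H →L[ℝ] H →L[ℝ] ℝ)
    (hsymm : ∀ u v, a u v = a v u) (hpos : ∀ u, 0 ≤ a u u)
    {α : ℝ} (hα : 0 < α) (hcoer : ∀ u, α * ‖u‖ ^ 2 ≤ a u u + inner ℝ (T u) (T u))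
    (N W : Submodule ℝ H) (hNc : IsClosed (N : Set H)) (hN : ∀ v ∈ N, T v = 0)
    (hW : ∀ w, w ∈ W ↔ ∀ v ∈ N, a w v = 0)
    (hinj : Function.Injective fun w : W => T w) (hcomp : IsCompactOperator fun w : W => T w)
    (hinf : ¬ FiniteDimensional ℝ T.range) :
    ∃ (μ : ℕ → ℝ) (e : ℕ → H), (∀ j, 0 ≤ μ j) ∧ Monotone μ ∧
      Filter.Tendsto μ Filter.atTop Filter.atTop ∧
      (∀ j, e j ≠ 0 ∧ ∀ φ, a (e j) φ = μ j * inner ℝ (T (e j)) (T φ)) ∧ (∀ j, e j ∈ W) ∧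
      (∀ i j, a (e i) (e j) + inner ℝ (T (e i)) (T (e j)) = if i = j then 1 else 0) ∧
      ∀ w ∈ W, ∀ ε > 0, ∃ v ∈ Submodule.span ℝ (Set.range e),
        a (w - v) (w - v) + inner ℝ (T (w - v)) (T (w - v)) < ε ^ 2 := by
  let b : H →L[ℝ] H →L[ℝ] ℝ := (innerSL ℝ : G →L⋆[ℝ] G →L[ℝ] ℝ).bilinearComp T T
  obtain ⟨E, _, _, _, Φ, hΦ⟩ := exists_equiv_inner_eq_of_coercive (a + b)
    (fun u v => congrArg₂ (· + ·) (hsymm u v) (real_inner_comm _ _)) hα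
    hcoer
  replace hΦ : ∀ u v, inner ℝ (Φ u) (Φ v) = a u v + inner ℝ (T u) (T v) := fun u v => hΦ u v
  let K : Submodule ℝ E := N.comap (Φ.symm : E →L[ℝ] H).toLinearMap
  have hKc : IsClosed (K : Set E) := hNc.preimage Φ.symm.continuous
  have : CompleteSpace K := hKc.completeSpace_coe
  have hKW : ∀ x, x ∈ Kᗮ ↔ Φ.symm x ∈ W := fun x => by
    rw [hW, Submodule.mem_orthogonal]
    constructor
    · intro h v hv
      have h1 := h (Φ v) (by simpa [K] using hv)
      rw [← Φ.apply_symm_apply x, hΦ, hN v hv, inner_zero_left, add_zero] at h1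
      rw [hsymm, h1]
    · intro h y hy
      have hy' : Φ.symm y ∈ N := hy
      rw [← Φ.apply_symm_apply x, ← Φ.apply_symm_apply y, hΦ, hN _ hy', inner_zero_left,
        add_zero, hsymm]
      exact h _ hy'
  let g : Kᗮ →L[ℝ] W := ((Φ.symm : E →L[ℝ] H) ∘L Kᗮ.subtypeL).codRestrict W
    (fun x => (hKW x).1 x.2)
  let T' : Kᗮ →L[ℝ] G := T ∘L (Φ.symm : E →L[ℝ] H) ∘L Kᗮ.subtypeL
  -- every element of `H` has a harmonic representative with the same trace
  have hdec : ∀ φ : H, ∃ x : Kᗮ, T' x = T φ ∧ ∀ y : Kᗮ, inner ℝ (y : E) (Φ φ) = inner ℝ y x := by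
    intro φ
    obtain ⟨p, hp, q, hq, hpq⟩ := K.exists_add_mem_mem_orthogonal (Φ φ)
    refine ⟨⟨q, hq⟩, ?_, fun y => ?_⟩
    · have h1 : φ = Φ.symm p + Φ.symm q := by rw [← map_add, ← hpq, Φ.symm_apply_apply]
      rw [h1, map_add, hN (Φ.symm p) hp, zero_add]
      rfl
    · rw [hpq, inner_add_right, K.inner_left_of_mem_orthogonal hp y.2, zero_add]
      rfl
  have hinf' : ¬ FiniteDimensional ℝ Kᗮ := fun h => by
    refine hinf (Submodule.finiteDimensional_of_le (S₂ := T'.range) ?_)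
    rintro _ ⟨φ, rfl⟩
    obtain ⟨x, hx, -⟩ := hdec φ
    exact ⟨x, hx⟩
  let S : Kᗮ →L[ℝ] Kᗮ := T'.adjoint ∘L T'
  have hSin : ∀ x y : Kᗮ, inner ℝ x (S y) = inner ℝ (T' x) (T' y) := fun x y =>
    T'.adjoint_inner_right x (T' y)
  have hSc : IsCompactOperator S :=
    IsCompactOperator.clm_comp (hcomp.comp_clm g : IsCompactOperator T') T'.adjoint
  have hSs : S.IsSymmetric := fun x y => by
    change inner ℝ (S x) y = inner ℝ x (S y)
    rw [real_inner_comm, hSin, hSin, real_inner_comm]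
  have hSp : ∀ x, x ≠ 0 → 0 < inner ℝ x (S x) := fun x hx => by
    rw [hSin, real_inner_self_eq_norm_sq]
    have : T' x ≠ 0 := fun h => hx <| by
      have h1 : g x = 0 := hinj (by simpa using! h)
      have h2 : Φ.symm x = 0 := congrArg Subtype.val h1
      simpa using h2
    positivity
  obtain ⟨f, l, hon, hf, hl, hanti, htend, hdense⟩ :=
    exists_orthonormal_eigenvectors_antitone hinf' hSc hSs hSp
  -- the weak eigenvalue equation, against arbitrary and not only harmonic `φ`
  have hb : ∀ j φ, inner ℝ (T (Φ.symm (f j))) (T φ) =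
      l j * (a (Φ.symm (f j)) φ + inner ℝ (T (Φ.symm (f j))) (T φ)) := fun j φ => by
    obtain ⟨x, hx, hx'⟩ := hdec φ
    rw [← hΦ, Φ.apply_symm_apply, hx', ← hx]
    change inner ℝ (T' (f j)) (T' x) = _
    rw [← hSin, ← hSs.apply_clm, hf, inner_smul_left]
    rfl
  have honΦ : ∀ i j, a (Φ.symm (f i)) (Φ.symm (f j)) +
      inner ℝ (T (Φ.symm (f i))) (T (Φ.symm (f j))) = if i = j then 1 else 0 := fun i j => by
    rw [← hΦ, Φ.apply_symm_apply, Φ.apply_symm_apply]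
    exact orthonormal_iff_ite.1 hon i j
  have hle : ∀ j, l j ≤ 1 := fun j => by
    have h1 := hb j (Φ.symm (f j))
    have h2 := honΦ j j
    rw [if_pos rfl] at h2
    rw [h2, mul_one] at h1
    linarith [hpos (Φ.symm (f j))]
  refine ⟨fun j => (l j)⁻¹ - 1, fun j => Φ.symm (f j), fun j => ?_, fun i j hij => ?_, ?_,
    fun j => ⟨?_, fun φ => ?_⟩, fun j => (hKW _).1 (f j).2, honΦ, fun w hw ε hε => ?_⟩
  · exact sub_nonneg.2 ((one_le_inv₀ (hl j)).2 (hle j))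
  · exact sub_le_sub_right (inv_anti₀ (hl j) (hanti hij)) 1
  · refine Filter.tendsto_atTop_add_const_right _ (-1) (Filter.Tendsto.inv_tendsto_nhdsGT_zero ?_)
    exact tendsto_nhdsWithin_iff.2 ⟨htend, Filter.Eventually.of_forall hl⟩
  · simpa using hon.ne_zero j
  · have h := hb j φ
    have := (hl j).ne'
    field_simp
    linarith
  · let w' : Kᗮ := ⟨Φ w, (hKW _).2 (by simpa using hw)⟩
    have hw' : w' ∈ (Submodule.span ℝ (Set.range f)).topologicalClosure := by
      rw [hdense]; trivial
    obtain ⟨v, hv, hvw⟩ := Metric.mem_closure_iff.1 hw' ε hε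
    refine ⟨Φ.symm v, ?_, ?_⟩
    · have h1 : Φ.symm v ∈ (Submodule.span ℝ (Set.range f)).map
          ((Φ.symm : E →L[ℝ] H) ∘L Kᗮ.subtypeL).toLinearMap := ⟨v, hv, rfl⟩
      rwa [Submodule.map_span, ← Set.range_comp] at h1
    · rw [← hΦ, real_inner_self_eq_norm_sq, map_sub, Φ.apply_symm_apply]
      rw [dist_eq_norm] at hvw
      have h2 : ‖Φ w - v‖ < ε := hvw
      gcongr

/-! ### Sobolev functions and traces -/

namespace Steklov

variable {d : ℕ} {Ω : Set (EuclideanSpace ℝ (Fin d))}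

theorem IsTestFunction.memLp_smul_const {φ : EuclideanSpace ℝ (Fin d) → ℝ}
    (hφ : IsTestFunction Ω φ) (y : EuclideanSpace ℝ (Fin d)) :
    MemLp (fun x => φ x • y) 2 (volume.restrict Ω) :=
  (ContinuousLinearMap.toSpanSingleton ℝ y).comp_memLp' hφ.memLp

/-- The weak gradient identities are closed conditions, as they are inner products with fixed
square integrable functions. -/
theorem isClosed_sobolevH1 : IsClosed (sobolevH1 Ω : Set (WithLp 2
    (Lp ℝ 2 (volume.restrict Ω) × Lp (EuclideanSpace ℝ (Fin d)) 2 (volume.restrict Ω)))) := by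
  have h : (sobolevH1 Ω : Set (WithLp 2 (Lp ℝ 2 (volume.restrict Ω) ×
      Lp (EuclideanSpace ℝ (Fin d)) 2 (volume.restrict Ω)))) =
      ⋂ (φ : EuclideanSpace ℝ (Fin d) → ℝ) (hφ : IsTestFunction Ω φ)
        (y : EuclideanSpace ℝ (Fin d)),
        {p | inner ℝ p.fst (hφ.memLp_fderiv y).toLp =
          - inner ℝ p.snd (hφ.memLp_smul_const y).toLp} := by
    ext p
    simp only [Set.mem_iInter, Set.mem_ofPred_eq, SetLike.mem_coe]
    refine forall_congr' fun φ => forall_congr' fun hφ => forall_congr' fun y => ?_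
    have h1 : inner ℝ p.fst (hφ.memLp_fderiv y).toLp =
        ∫ x in Ω, p.fst x * fderiv ℝ φ x y := by
      rw [L2.inner_def]
      refine integral_congr_ae ?_
      filter_upwards [(hφ.memLp_fderiv y).coeFn_toLp] with x hx
      rw [hx]
      simp [mul_comm]
    have h2 : inner ℝ p.snd (hφ.memLp_smul_const y).toLp =
        ∫ x in Ω, inner ℝ (p.snd x) y * φ x := by
      rw [L2.inner_def]
      refine integral_congr_ae ?_
      filter_upwards [(hφ.memLp_smul_const y).coeFn_toLp] with x hx
      rw [hx, inner_smul_right, mul_comm]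
    rw [h1, h2]
  rw [h]
  refine isClosed_iInter fun φ => isClosed_iInter fun hφ => isClosed_iInter fun y => ?_
  refine isClosed_eq ?_ ?_
  · exact (WithLp.continuous_fst 2 _ _).inner continuous_const
  · exact ((WithLp.continuous_snd 2 _ _).inner continuous_const).neg

instance : CompleteSpace (H1 Ω) :=
  (isClosed_sobolevH1 (Ω := Ω)).completeSpace_coe

/-- The classical gradient of a smooth function is its weak gradient. -/
theorem isWeakGradient_gradient {φ : EuclideanSpace ℝ (Fin d) → ℝ} (hφ : ContDiff ℝ ∞ φ) :
    IsWeakGradient Ω φ (gradient φ) := by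
  intro ψ hψ y
  have hφ' : Continuous fun x => fderiv ℝ φ x y :=
    (hφ.continuous_fderiv (by simp)).clm_apply continuous_const
  have hψ' : Continuous fun x => fderiv ℝ ψ x y :=
    (hψ.1.continuous_fderiv (by simp)).clm_apply continuous_const
  have hψc : HasCompactSupport fun x => fderiv ℝ ψ x y := hψ.2.1.fderiv_apply (𝕜 := ℝ) y
  have hout : ∀ x ∉ Ω, ψ x = 0 ∧ fderiv ℝ ψ x y = 0 := fun x hx => by
    have hx' : x ∉ tsupport ψ := fun h => hx (hψ.2.2 h)
    refine ⟨image_eq_zero_of_notMem_tsupport hx', ?_⟩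
    have : fderiv ℝ ψ x = 0 := by
      by_contra h
      exact hx' (support_fderiv_subset ℝ h)
    rw [this]; rfl
  rw [setIntegral_eq_integral_of_forall_compl_eq_zero (fun x hx => by rw [(hout x hx).2, mul_zero]),
    setIntegral_eq_integral_of_forall_compl_eq_zero (fun x hx => by rw [(hout x hx).1, mul_zero]),
    integral_mul_fderiv_eq_neg_fderiv_mul_of_integrable]
  · simp only [gradient, InnerProductSpace.toDual_symm_apply]
  · exact (hφ'.mul hψ.1.continuous).integrable_of_hasCompactSupport hψ.2.1.mul_left
  · exact (hφ.continuous.mul hψ').integrable_of_hasCompactSupport hψc.mul_left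
  · exact (hφ.continuous.mul hψ.1.continuous).integrable_of_hasCompactSupport hψ.2.1.mul_left
  · exact fun x _ => hφ.differentiable (by simp) x
  · exact fun x _ => hψ.1.differentiable (by simp) x

theorem exists_H1_of_contDiff {φ : EuclideanSpace ℝ (Fin d) → ℝ} (hφ : ContDiff ℝ ∞ φ)
    (hc : HasCompactSupport φ) : ∃ u : H1 Ω, u.toL2 =ᵐ[volume.restrict Ω] φ := by
  have h1 : MemLp φ 2 (volume.restrict Ω) :=
    (hφ.continuous.memLp_of_hasCompactSupport hc).restrict Ω
  have h2 : MemLp (gradient φ) 2 (volume.restrict Ω) := by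
    have hg : Continuous (gradient φ) :=
      (InnerProductSpace.toDual ℝ _).symm.continuous.comp (hφ.continuous_fderiv (by simp))
    have hgc : HasCompactSupport (gradient φ) :=
      (hc.fderiv ℝ).comp_left (g := (InnerProductSpace.toDual ℝ _).symm) (map_zero _)
    exact (hg.memLp_of_hasCompactSupport hgc).restrict Ω
  refine ⟨⟨WithLp.toLp 2 (h1.toLp φ, h2.toLp (gradient φ)), ?_⟩, h1.coeFn_toLp⟩
  intro ψ hψ y
  have h := isWeakGradient_gradient (Ω := Ω) hφ ψ hψ y
  have e1 : ∫ x in Ω, (h1.toLp φ) x * fderiv ℝ ψ x y = ∫ x in Ω, φ x * fderiv ℝ ψ x y :=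
    integral_congr_ae (by filter_upwards [h1.coeFn_toLp] with x hx; rw [hx])
  have e2 : ∫ x in Ω, inner ℝ ((h2.toLp (gradient φ)) x) y * ψ x =
      ∫ x in Ω, inner ℝ (gradient φ x) y * ψ x :=
    integral_congr_ae (by filter_upwards [h2.coeFn_toLp] with x hx; rw [hx])
  exact e1.trans (h.trans (congrArg Neg.neg e2.symm))

theorem extendsRestriction_trace (htr : AdmitsTrace Ω) : ExtendsRestriction Ω (trace Ω) := by
  rw [trace, dif_pos htr]
  exact htr.choose_spec.1

/-- The trace of a smooth compactly supported function is its restriction to the boundary. -/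
theorem trace_ae_eq_of_contDiff (htr : AdmitsTrace Ω) {φ : EuclideanSpace ℝ (Fin d) → ℝ}
    (hφ : ContDiff ℝ ∞ φ) (hc : HasCompactSupport φ) {u : H1 Ω}
    (hu : u.toL2 =ᵐ[volume.restrict Ω] φ) : trace Ω u =ᵐ[surfaceMeasure Ω] φ := by
  obtain ⟨K, hK⟩ := hφ.lipschitzWith_of_hasCompactSupport hc (by simp)
  exact extendsRestriction_trace htr φ ⟨K, hK.lipschitzOnWith⟩ u hu

theorem trace_eq_zero_of_mem_H10 (hΩ : IsOpen Ω) (htr : AdmitsTrace Ω) {u : H1 Ω}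
    (hu : u ∈ H10 Ω) : trace Ω u = 0 := by
  have h : H10 Ω ≤ (trace Ω).ker := by
    refine Submodule.topologicalClosure_minimal _ ?_ (trace Ω).isClosed_ker
    rintro v ⟨φ, hφ, hv⟩
    have h1 := trace_ae_eq_of_contDiff htr hφ.1 hφ.2.1 hv
    have h2 : φ =ᵐ[surfaceMeasure Ω] 0 := by
      filter_upwards [ae_restrict_mem isClosed_frontier.measurableSet] with x hx
      refine image_eq_zero_of_notMem_tsupport fun hx' => ?_
      rw [hΩ.frontier_eq] at hx
      exact hx.2 (hφ.2.2 hx')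
    exact (Lp.eq_zero_iff_ae_eq_zero).2 (h1.trans h2)
  exact h hu

/-- If `Ω` admits a trace operator, then the surface measure of `∂Ω` is locally finite: smooth
cutoff functions have square integrable traces. -/
theorem isLocallyFiniteMeasure_surfaceMeasure (htr : AdmitsTrace Ω) :
    IsLocallyFiniteMeasure (surfaceMeasure Ω) := by
  refine ⟨fun x => ?_⟩
  let f : ContDiffBump x := ⟨1, 2, one_pos, one_lt_two⟩
  obtain ⟨u, hu⟩ := exists_H1_of_contDiff (Ω := Ω) f.contDiff f.hasCompactSupport
  have hf : MemLp f 2 (surfaceMeasure Ω) :=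
    (memLp_congr_ae (trace_ae_eq_of_contDiff htr f.contDiff f.hasCompactSupport hu)).1
      (Lp.memLp (trace Ω u))
  refine ⟨Metric.closedBall x 1, Metric.closedBall_mem_nhds x one_pos, ?_⟩
  refine lt_of_le_of_lt (measure_mono fun y hy => ?_)
    (hf.integrable_sq.measure_norm_ge_lt_top (ε := 1) one_pos)
  have : f y = 1 := f.one_of_mem_closedBall hy
  simp [this]

/-- Traces are dense in `L²(∂Ω)`: those of smooth functions already separate its elements. -/
theorem dense_range_trace (htr : AdmitsTrace Ω) :
    (trace Ω).range.topologicalClosure = ⊤ := by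
  rw [Submodule.topologicalClosure_eq_top_iff, Submodule.eq_bot_iff]
  intro g hg
  have := isLocallyFiniteMeasure_surfaceMeasure htr
  refine Lp.eq_zero_iff_ae_eq_zero.2 (ae_eq_zero_of_integral_contDiff_smul_eq_zero
    ((Lp.memLp g).locallyIntegrable one_le_two) fun φ hφ hc => ?_)
  obtain ⟨u, hu⟩ := exists_H1_of_contDiff (Ω := Ω) hφ hc
  have h := hg (trace Ω u) ⟨u, rfl⟩
  rw [L2.inner_def] at h
  rw [← h]
  refine integral_congr_ae ?_
  filter_upwards [trace_ae_eq_of_contDiff htr hφ hc hu] with x hx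
  rw [hx]
  simp [mul_comm]

theorem boundaryForm_eq_inner (u v : H1 Ω) :
    boundaryForm u v = inner ℝ (trace Ω u) (trace Ω v) := by
  rw [L2.inner_def, boundaryForm]
  simp [mul_comm]

theorem not_finiteDimensional_range_trace (htr : AdmitsTrace Ω)
    (hinf : ¬ FiniteDimensional ℝ (L2Boundary Ω)) : ¬ FiniteDimensional ℝ (trace Ω).range := by
  intro h
  have htop : (trace Ω).range = ⊤ := by
    rw [← dense_range_trace htr]
    exact ((trace Ω).range.closed_of_finiteDimensional.submodule_topologicalClosure_eq).symm
  rw [htop] at h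
  exact hinf (Module.Finite.equiv (Submodule.topEquiv (R := ℝ) (M := L2Boundary Ω)))

end Steklov

/-! ### Steklov eigenfunctions -/

theorem theorem3p8 {d : ℕ} (Ω : Set (EuclideanSpace ℝ (Fin d))) (hΩ : IsOpen Ω)
    (htr : Steklov.AdmitsTrace Ω)
    (hinf : ¬ FiniteDimensional ℝ (Steklov.L2Boundary Ω))
    (a : Steklov.H1 Ω →L[ℝ] Steklov.H1 Ω →L[ℝ] ℝ)
    (hsymm : ∀ u v, a u v = a v u)
    (hpos : ∀ u, 0 ≤ a u u)
    (hcoer : ∃ α > 0, ∀ u : Steklov.H1 Ω, α * ‖u‖ ^ 2 ≤ Steklov.form1 a u u)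
    (hinj : Function.Injective
      (fun w : Steklov.harmonicSpace a => Steklov.trace Ω (w : Steklov.H1 Ω)))
    (hcomp : IsCompactOperator
      (fun w : Steklov.harmonicSpace a => Steklov.trace Ω (w : Steklov.H1 Ω))) :
    ∃ (μ : ℕ → ℝ) (e : ℕ → Steklov.H1 Ω),
      (∀ j, 0 ≤ μ j) ∧ Monotone μ ∧ Filter.Tendsto μ Filter.atTop Filter.atTop ∧
      (∀ j, Steklov.IsSteklovEigenpair a (μ j) (e j)) ∧
      Steklov.IsCompleteOrthonormalSystem (Steklov.form1 a) (Steklov.harmonicSpace a) e := by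
  obtain ⟨α, hα, hcoer⟩ := hcoer
  simp only [Steklov.form1, Steklov.boundaryForm_eq_inner] at hcoer
  obtain ⟨μ, e, hμ, hmono, htend, heig, hmem, hon, hdense⟩ :=
    exists_complete_orthonormal_eigenpairs (Steklov.trace Ω) a hsymm hpos hα hcoer (Steklov.H10 Ω)
      (Steklov.harmonicSpace a) (Submodule.isClosed_topologicalClosure _)
      (fun _ hv => Steklov.trace_eq_zero_of_mem_H10 hΩ htr hv) (fun _ => Iff.rfl) hinj hcomp
      (Steklov.not_finiteDimensional_range_trace htr hinf)
  simp only [← Steklov.boundaryForm_eq_inner] at heig hon hdense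
  exact ⟨μ, e, hμ, hmono, htend, heig, hmem, hon, hdense⟩
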